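/- Let $\mathbb K\in\{\mathbb R,\mathbb C\}$ and $r,s,t\in\mathbb N_0\cup\{\infty\}$. Let $M$ be a $\sigma$-compact, finite-dimensional (Hausdorff, real) $C^r$-manifold, $N$ a $\sigma$-compact, finite-dimensional (Hausdorff, real) $C^s$-manifold, and let $E$, $F$ be Hausdorff locally convex $\mathbb K$-vector spaces. For compact $K\subseteq M$, let $C^r_K(M,E)$ be the space of $C^r$-maps $M\to E$ supported in $K$, with the compact-open $C^r$-topology (the initial topology with respect to the maps $\gamma\mapsto d^k(\gamma\circ\varphi^{-1})\in C(\varphi(U)\times(\mathbb R^{\dim M})^k,E)$, for all charts $\varphi\colon U\to\varphi(U)\subseteq\mathbb R^{\dim M}$ of $M$ and all integers $0\le k\le r$, the target spaces carrying the compact-open topology). Let $C^r_c(M,E)=\bigcup_K C^r_K(M,E)$ carry the locally convex direct limit topology, i.e. the finest locally convex vector topology making all inclusions $C^r_K(M,E)\to C^r_c(M,E)$ continuous; define $C^s_c(N,F)$ likewise. A map $g\colon W\to Y$ on an open subset $W$ of a Hausdorff locally convex $\mathbb K$-vector space $X$ to a Hausdorff locally convex $\mathbb K$-vector space $Y$ is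 called $C^t$ (over $\mathbb K$) if it is continuous, the iterated directional derivatives $d^kg(x,y_1,\dots,y_k)=(D_{y_k}\cdots D_{y_1}g)(x)$ over $\mathbb K$ exist for all integers $1\le k\le t$, $x\in W$ and $y_1,\dots,y_k\in X$, and the maps $d^kg\colon W\times X^k\to Y$ are continuous. ($C^r$-maps on $M$ are those which are $C^r$ over $\mathbb R$ in charts.) Let $\Omega\subseteq C^r_c(M,E)$ be open and let $f\colon\Omega\to C^s_c(N,F)$ be almost local, i.e. there exist locally finite covers $(U_n)_{n\in\mathbb N}$ of $M$ and $(V_n)_{n\in\mathbb N}$ of $N$ by relatively compact, open sets such that, for all $n\in\mathbb N$ and all $\gamma,\eta\in\Omega$, $$\gamma|_{U_n}=\eta|_{U_n}\ \Longrightarrow\ f(\gamma)|_{V_n}=f(\eta)|_{V_n}.$$ Assume that, for each compact set $K\subseteq M$, the restriction of $f$ to the open subset $\Omega\cap C^r_K(M,E)$ of $C^r_K(M,E)$ is $C^t$ as a map to $C^s_c(N,F)$. Then $f$ is $C^t$. -/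

import Mathlib

open Set Filter Topology TopologicalSpace
open scoped Manifold

set_option linter.unusedSectionVars false

noncomputable section

section Calculus

variable (𝕜 : Type*) [NontriviallyNormedField 𝕜]
  {X Y : Type*} [AddCommGroup X] [Module 𝕜 X] [TopologicalSpace X]
  [AddCommGroup Y] [Module 𝕜 Y] [TopologicalSpace Y]

/-- `d` is the directional derivative of `f` at `x` in the direction `v` (over `𝕜`), i.e. the limit
of `(f (x + h v) - f x) / h` as `0 ≠ h → 0` in `𝕜`. -/
def HasDirDeriv (f : X → Y) (x v : X) (d : Y) : Prop :=
  Tendsto (fun h : 𝕜 => h⁻¹ • (f (x + h • v) - f x)) (𝓝[≠] 0) (𝓝 d)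

open Classical in
/-- The directional derivative `(D_v f)(x)`, with value `0` if it does not exist. -/
def dirDeriv (f : X → Y) (x v : X) : Y :=
  if h : ∃ d, HasDirDeriv 𝕜 f x v d then h.choose else 0

/-- The iterated directional derivative, as a function of `x` for given directions:
`iterDirDeriv 𝕜 f k y x = (D_{y (k-1)} ⋯ D_{y 0} f)(x)`. -/
def iterDirDeriv (f : X → Y) : (k : ℕ) → (Fin k → X) → X → Y
  | 0, _ => f
  | k + 1, y => fun x => dirDeriv 𝕜 (iterDirDeriv f k (Fin.init y)) x (y (Fin.last k))

/-- The restriction of `f` to the open set `U` is a `C^t`-map over `𝕜` in the sense of Keller's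
`C^t_c`-theory: it is continuous, all iterated directional derivatives of order at most `t` exist
at all points of `U`, and the maps
`d^k f : U × X^k → Y`, `(x, y₁, …, y_k) ↦ (D_{y_k} ⋯ D_{y_1} f)(x)`, are continuous for `k ≤ t`.
This is meant for open `U` and Hausdorff `Y`; then it depends on the restriction of `f` to `U`
only. -/
structure IsCkOn (t : ℕ∞) (f : X → Y) (U : Set X) : Prop where
  exists_deriv : ∀ k : ℕ, (k : ℕ∞) < t → ∀ y : Fin k → X, ∀ x ∈ U, ∀ v : X,
    ∃ d, HasDirDeriv 𝕜 (iterDirDeriv 𝕜 f k y) x v d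
  continuousOn : ∀ k : ℕ, (k : ℕ∞) ≤ t →
    ContinuousOn (fun p : X × (Fin k → X) => iterDirDeriv 𝕜 f k p.2 p.1) (U ×ˢ univ)

variable {𝕜}

theorem HasDirDeriv.dirDeriv_eq [T2Space Y] {f : X → Y} {x v : X} {d : Y}
    (h : HasDirDeriv 𝕜 f x v d) : dirDeriv 𝕜 f x v = d := by
  have h' : ∃ d, HasDirDeriv 𝕜 f x v d := ⟨d, h⟩
  unfold dirDeriv
  rw [dif_pos h']
  exact tendsto_nhds_unique h'.choose_spec h

theorem HasDirDeriv.congr [ContinuousSMul 𝕜 X] [ContinuousAdd X]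
    {f g : X → Y} {x v : X} {d : Y} {U : Set X} (hU : IsOpen U) (hx : x ∈ U)
    (hfg : EqOn f g U) (h : HasDirDeriv 𝕜 f x v d) : HasDirDeriv 𝕜 g x v d := by
  refine Tendsto.congr' ?_ h
  have hc : Continuous (fun h : 𝕜 => x + h • v) := by fun_prop
  have hm : (fun h : 𝕜 => x + h • v) ⁻¹' U ∈ 𝓝 (0 : 𝕜) :=
    hc.continuousAt.preimage_mem_nhds (by simpa using hU.mem_nhds hx)
  filter_upwards [nhdsWithin_le_nhds hm] with a ha
  rw [hfg ha, hfg hx]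

theorem iterDirDeriv_zero_fun [T2Space Y] (k : ℕ) (y : Fin k → X) (x : X) :
    iterDirDeriv 𝕜 (0 : X → Y) k y x = 0 := by
  induction k generalizing x with
  | zero => rfl
  | succ k ih =>
    apply HasDirDeriv.dirDeriv_eq
    simp [HasDirDeriv, ih]

theorem IsCkOn.zero [T2Space Y] (t : ℕ∞) (U : Set X) : IsCkOn 𝕜 t (0 : X → Y) U := by
  refine ⟨fun k _ y x _ v => ⟨0, ?_⟩, fun k _ => ?_⟩
  · simp [HasDirDeriv, iterDirDeriv_zero_fun]
  · simp only [iterDirDeriv_zero_fun]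
    exact continuousOn_const

section Add

variable [IsTopologicalAddGroup Y] [T2Space Y] [ContinuousSMul 𝕜 X] [ContinuousAdd X]
  {t : ℕ∞} {f g : X → Y} {U : Set X}

theorem HasDirDeriv.add {x v : X} {a b : Y} (hf : HasDirDeriv 𝕜 f x v a)
    (hg : HasDirDeriv 𝕜 g x v b) : HasDirDeriv 𝕜 (f + g) x v (a + b) := by
  refine (Tendsto.add hf hg).congr fun h => ?_
  rw [← smul_add, Pi.add_apply, Pi.add_apply]
  congr 1
  abel

theorem IsCkOn.iterDirDeriv_add (hU : IsOpen U) (hf : IsCkOn 𝕜 t f U) (hg : IsCkOn 𝕜 t g U)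
    (k : ℕ) (hk : (k : ℕ∞) ≤ t) (y : Fin k → X) :
    EqOn (iterDirDeriv 𝕜 f k y + iterDirDeriv 𝕜 g k y) (iterDirDeriv 𝕜 (f + g) k y) U := by
  induction k with
  | zero => exact fun x _ => rfl
  | succ k ih =>
    intro x hx
    have hk' : (k : ℕ∞) < t := lt_of_lt_of_le (by exact_mod_cast Nat.lt_succ_self k) hk
    obtain ⟨a, ha⟩ := hf.exists_deriv k hk' (Fin.init y) x hx (y (Fin.last k))
    obtain ⟨b, hb⟩ := hg.exists_deriv k hk' (Fin.init y) x hx (y (Fin.last k))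
    simp only [Pi.add_apply, iterDirDeriv]
    rw [ha.dirDeriv_eq, hb.dirDeriv_eq,
      ((ha.add hb).congr hU hx (ih hk'.le (Fin.init y))).dirDeriv_eq]

theorem IsCkOn.add (hU : IsOpen U) (hf : IsCkOn 𝕜 t f U) (hg : IsCkOn 𝕜 t g U) :
    IsCkOn 𝕜 t (f + g) U := by
  refine ⟨fun k hk y x hx v => ?_, fun k hk => ?_⟩
  · obtain ⟨a, ha⟩ := hf.exists_deriv k hk y x hx v
    obtain ⟨b, hb⟩ := hg.exists_deriv k hk y x hx v
    exact ⟨a + b, (ha.add hb).congr hU hx (hf.iterDirDeriv_add hU hg k hk.le y)⟩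
  · exact ((hf.continuousOn k hk).add (hg.continuousOn k hk)).congr
      fun p hp => (hf.iterDirDeriv_add hU hg k hk p.2 hp.1).symm

end Add

section Map

variable [T2Space Y] [ContinuousSMul 𝕜 X] [ContinuousAdd X]
  {t : ℕ∞} {f : X → Y} {U : Set X} {L : Y →+ Y}

theorem HasDirDeriv.map (hL : Continuous L) (hc : ∀ (c : 𝕜) (w : Y), L (c • w) = c • L w)
    {x v : X} {a : Y} (hf : HasDirDeriv 𝕜 f x v a) :
    HasDirDeriv 𝕜 (fun z => L (f z)) x v (L a) := by
  refine ((hL.tendsto a).comp hf).congr fun h => ?_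
  simp only [Function.comp_apply, hc, map_sub]

theorem IsCkOn.iterDirDeriv_map (hU : IsOpen U) (hL : Continuous L)
    (hc : ∀ (c : 𝕜) (w : Y), L (c • w) = c • L w) (hf : IsCkOn 𝕜 t f U)
    (k : ℕ) (hk : (k : ℕ∞) ≤ t) (y : Fin k → X) :
    EqOn (fun z => L (iterDirDeriv 𝕜 f k y z)) (iterDirDeriv 𝕜 (fun z => L (f z)) k y) U := by
  induction k with
  | zero => exact fun x _ => rfl
  | succ k ih =>
    intro x hx
    have hk' : (k : ℕ∞) < t := lt_of_lt_of_le (by exact_mod_cast Nat.lt_succ_self k) hk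
    obtain ⟨a, ha⟩ := hf.exists_deriv k hk' (Fin.init y) x hx (y (Fin.last k))
    simp only [iterDirDeriv]
    rw [ha.dirDeriv_eq, ((ha.map hL hc).congr hU hx (ih hk'.le (Fin.init y))).dirDeriv_eq]

theorem IsCkOn.map (hU : IsOpen U) (hL : Continuous L)
    (hc : ∀ (c : 𝕜) (w : Y), L (c • w) = c • L w) (hf : IsCkOn 𝕜 t f U) :
    IsCkOn 𝕜 t (fun z => L (f z)) U := by
  refine ⟨fun k hk y x hx v => ?_, fun k hk => ?_⟩
  · obtain ⟨a, ha⟩ := hf.exists_deriv k hk y x hx v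
    exact ⟨L a, (ha.map hL hc).congr hU hx (hf.iterDirDeriv_map hU hL hc k hk.le y)⟩
  · exact (hL.comp_continuousOn (hf.continuousOn k hk)).congr
      fun p hp => (hf.iterDirDeriv_map hU hL hc k hk p.2 hp.1).symm

end Map

end Calculus

section FunctionSpaces

variable (r : ℕ∞) (EM : Type*) [NormedAddCommGroup EM] [NormedSpace ℝ EM]
  (M : Type*) [TopologicalSpace M] [ChartedSpace EM M]
  (E : Type*) [AddCommGroup E] [Module ℝ E] [TopologicalSpace E]

variable {M E} in
/-- `γ : M → E` is a `C^r`-map from the real `C^r`-manifold `M` (modelled on `EM`) to the locally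
convex space `E`: it is `C^r` in every chart of the maximal `C^r`-atlas of `M`. -/
def IsCkMap (γ : M → E) : Prop :=
  ∀ φ ∈ IsManifold.maximalAtlas 𝓘(ℝ, EM) (r : WithTop ℕ∞) M, IsCkOn ℝ r (γ ∘ φ.symm) φ.target

variable [IsTopologicalAddGroup E] [T2Space E]

/-- The additive group of compactly supported `C^r`-maps `M → E`. -/
def testMapSubgroup : AddSubgroup (M → E) where
  carrier := {γ | IsCkMap r EM γ ∧ HasCompactSupport γ}
  zero_mem' := ⟨fun φ _ => IsCkOn.zero r φ.target, HasCompactSupport.zero⟩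
  add_mem' := fun ha hb =>
    ⟨fun φ hφ => (ha.1 φ hφ).add φ.open_target (hb.1 φ hφ), ha.2.add hb.2⟩
  neg_mem' := fun ha =>
    ⟨fun φ hφ => (ha.1 φ hφ).map (L := -AddMonoidHom.id E) φ.open_target continuous_neg
      (fun c w => (smul_neg c w).symm), ha.2.neg⟩

/-- The additive group of `C^r`-maps `M → E` supported in the compact set `K`. -/
def testMapSubgroupIn (K : Compacts M) : AddSubgroup (M → E) where
  carrier := {γ | IsCkMap r EM γ ∧ tsupport γ ⊆ K}
  zero_mem' := ⟨fun φ _ => IsCkOn.zero r φ.target, by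
    simp [tsupport]⟩
  add_mem' := fun ha hb =>
    ⟨fun φ hφ => (ha.1 φ hφ).add φ.open_target (hb.1 φ hφ),
      (tsupport_add _ _).trans (union_subset ha.2 hb.2)⟩
  neg_mem' := fun {a} ha =>
    ⟨fun φ hφ => (ha.1 φ hφ).map (L := -AddMonoidHom.id E) φ.open_target continuous_neg
      (fun c w => (smul_neg c w).symm), by
      have h : tsupport (-a) = tsupport a := by simp [tsupport]
      rw [h]; exact ha.2⟩

/-- The space `C^r_c(M,E)` of compactly supported `C^r`-maps `M → E`. (A type of its own, so that
it does not carry the topology of pointwise convergence.) -/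
def TestMap : Type _ := testMapSubgroup r EM M E

/-- The space `C^r_K(M,E)` of `C^r`-maps `M → E` supported in `K`. -/
def TestMapIn (K : Compacts M) : Type _ := testMapSubgroupIn r EM M E K

instance : AddCommGroup (TestMap r EM M E) :=
  inferInstanceAs (AddCommGroup (testMapSubgroup r EM M E))

instance (K : Compacts M) : AddCommGroup (TestMapIn r EM M E K) :=
  inferInstanceAs (AddCommGroup (testMapSubgroupIn r EM M E K))

instance : CoeFun (TestMap r EM M E) (fun _ => M → E) := ⟨fun γ => γ.1⟩

instance (K : Compacts M) : CoeFun (TestMapIn r EM M E K) (fun _ => M → E) := ⟨fun γ => γ.1⟩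

section Module

variable {𝕜 : Type*} [Semiring 𝕜] [Module 𝕜 E] [SMulCommClass ℝ 𝕜 E] [ContinuousConstSMul 𝕜 E]

variable {r EM M E} in
theorem IsCkMap.const_smul (c : 𝕜) {γ : M → E} (h : IsCkMap r EM γ) : IsCkMap r EM (c • γ) :=
  fun φ hφ => (h φ hφ).map (L := DistribSMul.toAddMonoidHom E c) φ.open_target
    (continuous_const_smul c) (fun a w => (smul_comm a c w).symm)

instance : SMul 𝕜 (TestMap r EM M E) :=
  ⟨fun c γ => ⟨c • γ.1, γ.2.1.const_smul c,
    γ.2.2.mono' ((Function.support_const_smul_subset c γ.1).trans subset_closure)⟩⟩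

instance (K : Compacts M) : SMul 𝕜 (TestMapIn r EM M E K) :=
  ⟨fun c γ => ⟨c • γ.1, γ.2.1.const_smul c,
    (closure_mono (Function.support_const_smul_subset c γ.1)).trans γ.2.2⟩⟩

/-- Scalar multiplication on `C^r_c(M,E)` is pointwise. -/
instance : Module 𝕜 (TestMap r EM M E) :=
  Function.Injective.module 𝕜 (testMapSubgroup r EM M E).subtype Subtype.coe_injective
    fun _ _ => rfl

/-- Scalar multiplication on `C^r_K(M,E)` is pointwise. -/
instance (K : Compacts M) : Module 𝕜 (TestMapIn r EM M E K) :=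
  Function.Injective.module 𝕜 (testMapSubgroupIn r EM M E K).subtype Subtype.coe_injective
    fun _ _ => rfl

end Module

variable {r EM M E} in
/-- For a `C^r`-map `γ`, a chart `φ : U → V ⊆ EM` of the maximal atlas and `k ≤ r`, the continuous
map `d^k(γ ∘ φ⁻¹) : V × EM^k → E`. -/
def chartDeriv {γ : M → E} (hγ : IsCkMap r EM γ) {φ : OpenPartialHomeomorph M EM}
    (hφ : φ ∈ IsManifold.maximalAtlas 𝓘(ℝ, EM) (r : WithTop ℕ∞) M) {k : ℕ} (hk : (k : ℕ∞) ≤ r) :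
    C(φ.target × (Fin k → EM), E) where
  toFun p := iterDirDeriv ℝ (γ ∘ φ.symm) k p.2 p.1
  continuous_toFun :=
    ((hγ φ hφ).continuousOn k hk).comp_continuous
      (f := fun p : φ.target × (Fin k → EM) => ((p.1 : EM), p.2)) (by fun_prop)
      fun p => ⟨p.1.2, mem_univ _⟩

/-- The compact-open `C^r`-topology on `C^r_K(M,E)`: the initial topology with respect to the maps
`γ ↦ d^k(γ ∘ φ⁻¹) ∈ C(V × EM^k, E)`, for all charts `φ : U → V` and all `k ≤ r`, where the spaces
`C(V × EM^k, E)` carry the compact-open topology. -/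
instance (K : Compacts M) : TopologicalSpace (TestMapIn r EM M E K) :=
  ⨅ (φ : OpenPartialHomeomorph M EM)
    (hφ : φ ∈ IsManifold.maximalAtlas 𝓘(ℝ, EM) (r : WithTop ℕ∞) M) (k : ℕ) (hk : (k : ℕ∞) ≤ r),
    TopologicalSpace.induced (fun γ : TestMapIn r EM M E K => chartDeriv γ.2.1 hφ hk)
      ContinuousMap.compactOpen

variable {r EM M E} in
/-- The inclusion map `C^r_K(M,E) → C^r_c(M,E)`. -/
def TestMapIn.incl [R1Space M] {K : Compacts M} (γ : TestMapIn r EM M E K) : TestMap r EM M E :=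
  ⟨γ.1, γ.2.1, HasCompactSupport.of_support_subset_isCompact K.isCompact
    ((subset_tsupport _).trans γ.2.2)⟩

/-- The locally convex direct limit topology on `C^r_c(M,E)`: the finest locally convex vector
topology making all inclusion maps `C^r_K(M,E) → C^r_c(M,E)` continuous, for compact `K ⊆ M`.
(If `E` is a complex locally convex space, then this topology is also the finest complex locally
convex vector topology with this property, since multiplication by `i` is continuous on each
`C^r_K(M,E)` and hence on `C^r_c(M,E)`.) -/
instance [R1Space M] [ContinuousSMul ℝ E] : TopologicalSpace (TestMap r EM M E) :=
  sInf {τ : TopologicalSpace (TestMap r EM M E) |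
    (∀ K : Compacts M, @Continuous _ _ _ τ (TestMapIn.incl (r := r) (EM := EM) (E := E) (K := K))) ∧
    @IsTopologicalAddGroup _ τ _ ∧
    @ContinuousSMul ℝ _ _ _ τ ∧
    @LocallyConvexSpace ℝ _ _ _ _ _ τ}

end FunctionSpaces

section AlmostLocal

variable {r s : ℕ∞}
  {EM : Type*} [NormedAddCommGroup EM] [NormedSpace ℝ EM]
  {EN : Type*} [NormedAddCommGroup EN] [NormedSpace ℝ EN]
  {M : Type*} [TopologicalSpace M] [ChartedSpace EM M]
  {N : Type*} [TopologicalSpace N] [ChartedSpace EN N]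
  {E : Type*} [AddCommGroup E] [Module ℝ E] [TopologicalSpace E]
  [IsTopologicalAddGroup E] [T2Space E]
  {F : Type*} [AddCommGroup F] [Module ℝ F] [TopologicalSpace F]
  [IsTopologicalAddGroup F] [T2Space F]

/-- A locally finite cover of a topological space by relatively compact, open sets `W n` (some of
which may be empty). -/
structure IsLocFinRelCompactCover {Z : Type*} [TopologicalSpace Z] (W : ℕ → Set Z) : Prop where
  isOpen : ∀ n, IsOpen (W n)
  isCompact_closure : ∀ n, IsCompact (closure (W n))
  locallyFinite : LocallyFinite W
  iUnion_eq : ⋃ n, W n = univ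

/-- The restriction of `f` to `Ω ⊆ C^r_c(M,E)`, as a map to `C^s_c(N,F)`, is almost local: there
are locally finite covers `(U n)` of `M` and `(V n)` of `N` by relatively compact, open sets such
that, for `γ ∈ Ω`, the restriction of `f γ` to `V n` only depends on the restriction of `γ` to
`U n`. -/
def IsAlmostLocalOn (f : TestMap r EM M E → TestMap s EN N F) (Ω : Set (TestMap r EM M E)) : Prop :=
  ∃ (U : ℕ → Set M) (V : ℕ → Set N), IsLocFinRelCompactCover U ∧ IsLocFinRelCompactCover V ∧
    ∀ n, ∀ γ ∈ Ω, ∀ η ∈ Ω, EqOn γ η (U n) → EqOn (f γ) (f η) (V n)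

end AlmostLocal

end

/-! Finitely many test maps have their supports in one compact set `K`, so each directional
derivative of `f` is a derivative of its restriction to a step `C^r_K`. Existence is thus immediate;
the content is continuity of `d^k f` on the limit.

Since point evaluations are continuous, `d^k f` is again almost local for the same covers, jointly
in the base point and the directions (`TestMap.eqOn_iterDirDeriv`). It remains to see that a jointly
almost local `G` which is continuous on steps is continuous (`TestMap.continuousOn_of_almostLocal`).
Take a partition of unity `h n` subordinate to `V n`, and compactly supported `χ n` equal to `1` on
`U n`. By locality, `h n • (G p - G q)` does not change when `p` is replaced by `q + χ n • (p - q)`,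
which lies in a fixed step. There continuity makes it smaller than `ε n` in the gauge of a given
convex zero-neighbourhood, provided the components of `χ n • (p - q)` lie in some zero-neighbourhood
`P n`. With `∑ ε n < 1`, summing over `n` bounds `G p - G q`.

All these conditions hold together near `q`: on each step only finitely many are nontrivial, and an
absolutely convex set is a zero-neighbourhood of the limit once its traces on the steps are
(`TestMap.mem_nhds_zero_of_absConvex`). -/

noncomputable section

/-! ### Leibniz formula for iterated directional derivatives. -/

section Leibniz

variable {X Y : Type*} [AddCommGroup X] [Module ℝ X] [TopologicalSpace X]
  [AddCommGroup Y] [Module ℝ Y] [TopologicalSpace Y]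

/-- A choice of `i` and of `j` out of `k` directions, as it occurs in the Leibniz formula. -/
structure Splitting (k : ℕ) where
  i : ℕ
  j : ℕ
  left : Fin i → Fin k
  right : Fin j → Fin k

namespace Splitting

/-- Add the last direction to the left part. -/
def addLeft {k : ℕ} (S : Splitting k) : Splitting (k + 1) :=
  ⟨S.i + 1, S.j, Fin.snoc (α := fun _ => Fin (k + 1)) (Fin.castSucc ∘ S.left) (Fin.last k),
    Fin.castSucc ∘ S.right⟩

/-- Add the last direction to the right part. -/
def addRight {k : ℕ} (S : Splitting k) : Splitting (k + 1) :=
  ⟨S.i, S.j + 1, Fin.castSucc ∘ S.left,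
    Fin.snoc (α := fun _ => Fin (k + 1)) (Fin.castSucc ∘ S.right) (Fin.last k)⟩

/-- All splittings of `k` directions into two complementary parts. -/
def all : (k : ℕ) → List (Splitting k)
  | 0 => [⟨0, 0, Fin.elim0, Fin.elim0⟩]
  | k + 1 => (all k).map addLeft ++ (all k).map addRight

theorem le_of_mem_all {k : ℕ} {S : Splitting k} (hS : S ∈ all k) : S.i ≤ k ∧ S.j ≤ k := by
  induction k with
  | zero => simp only [all, List.mem_singleton] at hS; subst hS; simp
  | succ k ih =>
    simp only [all, List.mem_append, List.mem_map] at hS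
    rcases hS with ⟨T, hT, rfl⟩ | ⟨T, hT, rfl⟩
    · have := ih hT
      simp only [addLeft]
      omega
    · have := ih hT
      simp only [addRight]
      omega

/-- The summand of the Leibniz formula that belongs to a splitting. -/
def term (χ : X → ℝ) (γ : X → Y) {k : ℕ} (y : Fin k → X) (x : X) (S : Splitting k) : Y :=
  iterDirDeriv ℝ χ S.i (y ∘ S.left) x • iterDirDeriv ℝ γ S.j (y ∘ S.right) x

/-- A new direction is appended at the end of its part, matching `iterDirDeriv`, which
differentiates in the last direction last. -/
theorem comp_snoc_castSucc {k i : ℕ} (y : Fin (k + 1) → X) (σ : Fin i → Fin k) :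
    Fin.init (y ∘ Fin.snoc (α := fun _ => Fin (k + 1)) (Fin.castSucc ∘ σ) (Fin.last k)) =
      Fin.init y ∘ σ := by
  funext a
  simp [Fin.init]

theorem term_addLeft (χ : X → ℝ) (γ : X → Y) {k : ℕ} (y : Fin (k + 1) → X) (x : X)
    (S : Splitting k) : term χ γ y x S.addLeft =
      dirDeriv ℝ (iterDirDeriv ℝ χ S.i (Fin.init y ∘ S.left)) x (y (Fin.last k)) •
        iterDirDeriv ℝ γ S.j (Fin.init y ∘ S.right) x := by
  have h : y ∘ (Fin.castSucc ∘ S.right) = Fin.init y ∘ S.right := rfl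
  simp only [term, addLeft, iterDirDeriv, h]
  rw [comp_snoc_castSucc]
  simp

theorem term_addRight (χ : X → ℝ) (γ : X → Y) {k : ℕ} (y : Fin (k + 1) → X) (x : X)
    (S : Splitting k) : term χ γ y x S.addRight =
      iterDirDeriv ℝ χ S.i (Fin.init y ∘ S.left) x •
        dirDeriv ℝ (iterDirDeriv ℝ γ S.j (Fin.init y ∘ S.right)) x (y (Fin.last k)) := by
  have h : y ∘ (Fin.castSucc ∘ S.left) = Fin.init y ∘ S.left := rfl
  simp only [term, addRight, iterDirDeriv, h]
  rw [comp_snoc_castSucc]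
  simp

end Splitting

variable [IsTopologicalAddGroup Y] [ContinuousSMul ℝ Y]

/-- With difference quotients `A` of `χ` and `B` of `γ`, the quotient of the product is exactly `A •
γ x + χ x • B + h • (A • B)`. The last term vanishes in the limit, so continuity of the factors is
not needed. -/
theorem HasDirDeriv.smul {χ : X → ℝ} {γ : X → Y} {x v : X} {a : ℝ} {b : Y}
    (hχ : HasDirDeriv ℝ χ x v a) (hγ : HasDirDeriv ℝ γ x v b) :
    HasDirDeriv ℝ (fun z => χ z • γ z) x v (a • γ x + χ x • b) := by
  have h0 : Tendsto (fun h : ℝ => h) (𝓝[≠] 0) (𝓝 0) := tendsto_id.mono_left nhdsWithin_le_nhds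
  have hχ' : Tendsto (fun h : ℝ => h⁻¹ • (χ (x + h • v) - χ x)) (𝓝[≠] 0) (𝓝 a) := hχ
  have hγ' : Tendsto (fun h : ℝ => h⁻¹ • (γ (x + h • v) - γ x)) (𝓝[≠] 0) (𝓝 b) := hγ
  have h2 := ((hχ'.smul (tendsto_const_nhds (x := γ x))).add
    ((tendsto_const_nhds (x := χ x)).smul hγ')).add (h0.smul (hχ'.smul hγ'))
  rw [zero_smul, add_zero] at h2
  refine h2.congr' ?_
  filter_upwards [self_mem_nhdsWithin] with h hh
  have hh' : (h : ℝ) ≠ 0 := hh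
  set A := χ (x + h • v)
  set B := γ (x + h • v)
  simp only [smul_sub, smul_smul, sub_smul, smul_eq_mul, mul_sub]
  have e : h * (h⁻¹ * A) = A := by field_simp
  have e' : h * (h⁻¹ * χ x) = χ x := by field_simp
  have e1 : h * ((h⁻¹ * A - h⁻¹ * χ x) * h⁻¹) = h⁻¹ * A - h⁻¹ * χ x := by field_simp
  simp only [e1, sub_smul, mul_comm (χ x)]
  abel

theorem HasDirDeriv.list_sum {ι : Type*} {g : ι → X → Y} {d : ι → Y} {x v : X} (l : List ι)
    (h : ∀ i ∈ l, HasDirDeriv ℝ (g i) x v (d i)) :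
    HasDirDeriv ℝ (fun z => (l.map fun i => g i z).sum) x v (l.map d).sum := by
  induction l with
  | nil => simpa [HasDirDeriv] using tendsto_const_nhds
  | cons i l ih =>
    simp only [List.map_cons, List.sum_cons]
    refine (Tendsto.add (h i (by simp)) (ih fun j hj => h j (by simp [hj]))).congr fun t => ?_
    rw [← smul_add, add_sub_add_comm]

variable [T2Space Y] [ContinuousSMul ℝ X] [ContinuousAdd X]
  {r : ℕ∞} {χ : X → ℝ} {γ : X → Y} {U : Set X}

theorem IsCkOn.hasDirDeriv (hγ : IsCkOn ℝ r γ U) {k : ℕ} (hk : (k : ℕ∞) < r) (y : Fin k → X)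
    {x : X} (hx : x ∈ U) (v : X) :
    HasDirDeriv ℝ (iterDirDeriv ℝ γ k y) x v (dirDeriv ℝ (iterDirDeriv ℝ γ k y) x v) := by
  obtain ⟨d, hd⟩ := hγ.exists_deriv k hk y x hx v
  rwa [hd.dirDeriv_eq]

/-- The product rule turns each summand into its `addLeft` and `addRight` descendants, which is how
`Splitting.all (k + 1)` arises from `Splitting.all k`. -/
theorem IsCkOn.hasDirDeriv_sum_term (hχ : IsCkOn ℝ r χ U) (hγ : IsCkOn ℝ r γ U)
    {k : ℕ} (hk : (k : ℕ∞) < r) (y : Fin (k + 1) → X) {x : X} (hx : x ∈ U) :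
    HasDirDeriv ℝ (fun z => ((Splitting.all k).map (Splitting.term χ γ (Fin.init y) z)).sum) x
      (y (Fin.last k)) ((Splitting.all (k + 1)).map (Splitting.term χ γ y x)).sum := by
  have key := HasDirDeriv.list_sum (x := x) (v := y (Fin.last k))
    (g := fun S z => Splitting.term χ γ (Fin.init y) z S)
    (d := fun S => Splitting.term χ γ y x S.addLeft + Splitting.term χ γ y x S.addRight)
    (Splitting.all k) (fun S hS => by
      obtain ⟨hi, hj⟩ := Splitting.le_of_mem_all hS
      have hi' : (S.i : ℕ∞) < r := lt_of_le_of_lt (by exact_mod_cast hi) hk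
      have hj' : (S.j : ℕ∞) < r := lt_of_le_of_lt (by exact_mod_cast hj) hk
      rw [Splitting.term_addLeft, Splitting.term_addRight]
      exact (hχ.hasDirDeriv hi' _ hx _).smul (hγ.hasDirDeriv hj' _ hx _))
  rw [List.sum_map_add] at key
  simpa [Splitting.all, Function.comp_def] using key

/-- The Leibniz formula for iterated directional derivatives. -/
theorem IsCkOn.iterDirDeriv_smul (hU : IsOpen U) (hχ : IsCkOn ℝ r χ U) (hγ : IsCkOn ℝ r γ U)
    {k : ℕ} (hk : (k : ℕ∞) ≤ r) (y : Fin k → X) {x : X} (hx : x ∈ U) :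
    iterDirDeriv ℝ (fun z => χ z • γ z) k y x =
      ((Splitting.all k).map (Splitting.term χ γ y x)).sum := by
  induction k generalizing x with
  | zero =>
    simp [Splitting.all, Splitting.term, iterDirDeriv]
  | succ k ih =>
    have hk' : (k : ℕ∞) < r := lt_of_lt_of_le (by exact_mod_cast Nat.lt_succ_self k) hk
    exact ((hχ.hasDirDeriv_sum_term hγ hk' y hx).congr hU hx
      fun z hz => (ih hk'.le (Fin.init y) hz).symm).dirDeriv_eq

theorem IsCkOn.continuousOn_comp (hγ : IsCkOn ℝ r γ U) {k i : ℕ} (hi : (i : ℕ∞) ≤ r)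
    (σ : Fin i → Fin k) :
    ContinuousOn (fun p : X × (Fin k → X) => iterDirDeriv ℝ γ i (p.2 ∘ σ) p.1) (U ×ˢ univ) :=
  (hγ.continuousOn i hi).comp (f := fun p : X × (Fin k → X) => (p.1, p.2 ∘ σ))
    (Continuous.continuousOn (continuous_fst.prodMk
      (continuous_pi fun j => (continuous_apply (σ j)).comp continuous_snd)))
    fun _ hp => ⟨hp.1, mem_univ _⟩

theorem IsCkOn.smul (hU : IsOpen U) (hχ : IsCkOn ℝ r χ U) (hγ : IsCkOn ℝ r γ U) :
    IsCkOn ℝ r (fun z => χ z • γ z) U := by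
  refine ⟨fun k hk y x hx v => ?_, fun k hk => ?_⟩
  · have h := hχ.hasDirDeriv_sum_term hγ hk (Fin.snoc (α := fun _ => X) y v) hx
    rw [Fin.init_snoc, Fin.snoc_last] at h
    exact ⟨_, h.congr hU hx fun z hz => (hχ.iterDirDeriv_smul hU hγ hk.le y hz).symm⟩
  · refine ContinuousOn.congr ?_ fun p hp => hχ.iterDirDeriv_smul hU hγ hk p.2 hp.1
    refine continuousOn_list_sum (f := fun S (p : X × (Fin k → X)) =>
      Splitting.term χ γ p.2 p.1 S) _ fun S hS => ?_
    obtain ⟨hi, hj⟩ := Splitting.le_of_mem_all hS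
    exact (hχ.continuousOn_comp ((by exact_mod_cast hi : (S.i : ℕ∞) ≤ k).trans hk) S.left).smul
      (hγ.continuousOn_comp ((by exact_mod_cast hj : (S.j : ℕ∞) ≤ k).trans hk) S.right)

end Leibniz

/-! ### Comparison with Fréchet differentiability. -/

section ContDiff

variable {V : Type*} [NormedAddCommGroup V] [NormedSpace ℝ V]
  {G : Type*} [NormedAddCommGroup G] [NormedSpace ℝ G] {r : ℕ∞} {g : V → G} {U : Set V}

theorem hasDirDeriv_iteratedFDeriv (hU : IsOpen U) (hg : ContDiffOn ℝ r g U) {k : ℕ}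
    (hk : (k : ℕ∞) < r) (y : Fin k → V) {x : V} (hx : x ∈ U) (v : V) :
    HasDirDeriv ℝ (fun z => iteratedFDeriv ℝ k g z y) x v
      (iteratedFDeriv ℝ (k + 1) g x (Fin.cons v y)) := by
  have hd : DifferentiableAt ℝ (iteratedFDeriv ℝ k g) x :=
    (hg.contDiffAt (hU.mem_nhds hx)).differentiableAt_iteratedFDeriv (by exact_mod_cast hk)
  have h1 : HasFDerivAt (fun z => iteratedFDeriv ℝ k g z y)
      ((ContinuousMultilinearMap.apply ℝ (fun _ : Fin k => V) G y).comp
        (fderiv ℝ (iteratedFDeriv ℝ k g) x)) x :=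
    (ContinuousMultilinearMap.apply ℝ (fun _ : Fin k => V) G y).hasFDerivAt.comp x hd.hasFDerivAt
  have h2 := h1.hasLineDerivAt v
  rw [iteratedFDeriv_succ_apply_left]
  exact h2.tendsto_slope_zero

/-- `iteratedFDeriv` takes the newest direction first, `iterDirDeriv` last; reversing the order
avoids any appeal to symmetry of derivatives. -/
theorem iterDirDeriv_eq_iteratedFDeriv (hU : IsOpen U) (hg : ContDiffOn ℝ r g U) {k : ℕ}
    (hk : (k : ℕ∞) ≤ r) (y : Fin k → V) {x : V} (hx : x ∈ U) :
    iterDirDeriv ℝ g k y x = iteratedFDeriv ℝ k g x (y ∘ Fin.rev) := by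
  induction k generalizing x with
  | zero => simp [iterDirDeriv]
  | succ k ih =>
    have hk' : (k : ℕ∞) < r := lt_of_lt_of_le (by exact_mod_cast Nat.lt_succ_self k) hk
    have e : y ∘ Fin.rev = Fin.cons (α := fun _ => V) (y (Fin.last k)) (Fin.init y ∘ Fin.rev) := by
      funext i
      refine Fin.cases ?_ (fun j => ?_) i
      · simp
      · simp [Fin.init, Fin.rev_succ]
    rw [e]
    exact ((hasDirDeriv_iteratedFDeriv hU hg hk' (Fin.init y ∘ Fin.rev) hx _).congr hU hx
      fun z hz => (ih hk'.le (Fin.init y) hz).symm).dirDeriv_eq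

theorem ContDiffOn.isCkOn (hU : IsOpen U) (hg : ContDiffOn ℝ r g U) : IsCkOn ℝ r g U := by
  refine ⟨fun k hk y x hx v => ⟨_, (hasDirDeriv_iteratedFDeriv hU hg hk (y ∘ Fin.rev) hx v).congr
    hU hx fun z hz => (iterDirDeriv_eq_iteratedFDeriv hU hg hk.le y hz).symm⟩, fun k hk => ?_⟩
  refine ContinuousOn.congr ?_ fun p hp => iterDirDeriv_eq_iteratedFDeriv hU hg hk p.2 hp.1
  have h1 : ContinuousOn (iteratedFDeriv ℝ k g) U :=
    (hg.continuousOn_iteratedFDerivWithin (by exact_mod_cast hk) hU.uniqueDiffOn).congr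
      fun x hx => (iteratedFDerivWithin_of_isOpen k hU hx).symm
  have h2 : ContinuousOn (fun p : V × (Fin k → V) =>
      (iteratedFDeriv ℝ k g p.1, p.2 ∘ Fin.rev)) (U ×ˢ univ) :=
    (h1.comp continuousOn_fst fun p hp => hp.1).prodMk
      (Continuous.continuousOn (continuous_pi fun j =>
        (continuous_apply (Fin.rev j)).comp continuous_snd))
  exact continuous_eval.comp_continuousOn h2

end ContDiff

/-! ### Bump functions, partitions of unity and plateau functions. -/

section Bump

variable {r : ℕ∞} {EM : Type*} [NormedAddCommGroup EM] [NormedSpace ℝ EM]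
  {M : Type*} [TopologicalSpace M] [ChartedSpace EM M]

/-- The composition of a real-valued `C^r`-map with the inverse of a chart is `C^r`. -/
theorem ContMDiff.isCkOn_comp_symm {χ : M → ℝ} (hχ : ContMDiff 𝓘(ℝ, EM) 𝓘(ℝ, ℝ) r χ)
    {φ : OpenPartialHomeomorph M EM}
    (hφ : φ ∈ IsManifold.maximalAtlas 𝓘(ℝ, EM) (r : WithTop ℕ∞) M) :
    IsCkOn ℝ r (χ ∘ φ.symm) φ.target :=
  ContDiffOn.isCkOn φ.open_target
    (contMDiffOn_iff_contDiffOn.1 (hχ.comp_contMDiffOn (contMDiffOn_symm_of_mem_maximalAtlas hφ)))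

variable [FiniteDimensional ℝ EM] [T2Space M] [IsManifold 𝓘(ℝ, EM) (r : WithTop ℕ∞) M]

/-- A bump function is smooth in the chart coordinates, hence as regular as the chart, here `C^r`.
-/
theorem SmoothBumpFunction.contMDiff_of_isManifold {c : M} (f : SmoothBumpFunction 𝓘(ℝ, EM) c) :
    ContMDiff 𝓘(ℝ, EM) 𝓘(ℝ, ℝ) r f := by
  refine contMDiff_of_tsupport fun x hx => ?_
  have hx' : x ∈ (chartAt EM c).source := f.tsupport_subset_chartAt_source hx
  refine ContMDiffAt.congr_of_eventuallyEq ?_ <| f.eqOn_source.eventuallyEq_of_mem <|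
    (chartAt EM c).open_source.mem_nhds hx'
  exact f.contDiffAt.contMDiffAt.comp _ (contMDiffAt_extChartAt' hx')

/-- For a compact set `A` in an open set `V`, there is a nonnegative `C^r`-function that is positive
on `A` and vanishes outside `V`. -/
theorem exists_contMDiff_pos_on_compact (r : ℕ∞) [IsManifold 𝓘(ℝ, EM) (r : WithTop ℕ∞) M]
    {A V : Set M} (hA : IsCompact A) (hV : IsOpen V) (hAV : A ⊆ V) :
    ∃ g : M → ℝ, ContMDiff 𝓘(ℝ, EM) 𝓘(ℝ, ℝ) r g ∧ (∀ x, 0 ≤ g x) ∧ (∀ x ∈ A, 0 < g x) ∧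
      Function.support g ⊆ V := by
  have h : ∀ c : M, c ∈ A → ∃ b : SmoothBumpFunction 𝓘(ℝ, EM) c, tsupport b ⊆ V := fun c hc => by
    obtain ⟨b, hb, -⟩ := (SmoothBumpFunction.nhds_basis_support (I := 𝓘(ℝ, EM))
      (hV.mem_nhds (hAV hc))).mem_iff.1 univ_mem
    exact ⟨b, hb⟩
  choose! b hb using h
  obtain ⟨t, htA, ht⟩ := hA.elim_nhds_subcover (fun c => Function.support (b c))
    fun c _ => (b c).support_mem_nhds
  refine ⟨fun x => ∑ c ∈ t, b c x, ?_, fun x => Finset.sum_nonneg fun c _ => (b c).nonneg, ?_, ?_⟩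
  · exact contMDiff_finsetSum fun c _ => (b c).contMDiff_of_isManifold
  · intro x hx
    obtain ⟨c, hc, hxc⟩ := mem_iUnion₂.1 (ht hx)
    exact Finset.sum_pos' (fun c _ => (b c).nonneg)
      ⟨c, hc, lt_of_le_of_ne (b c).nonneg (Ne.symm hxc)⟩
  · intro x hx
    obtain ⟨c, hc, hxc⟩ := Finset.exists_ne_zero_of_sum_ne_zero hx
    exact hb c (htA c hc) (subset_tsupport _ hxc)

/-- Every locally finite cover by relatively compact open sets has a subordinate partition of unity
of class `C^r`. -/
theorem IsLocFinRelCompactCover.exists_partition (r : ℕ∞) [SigmaCompactSpace M]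
    [IsManifold 𝓘(ℝ, EM) (r : WithTop ℕ∞) M]
    {V : ℕ → Set M} (hV : IsLocFinRelCompactCover V) :
    ∃ h : ℕ → M → ℝ, (∀ n, ContMDiff 𝓘(ℝ, EM) 𝓘(ℝ, ℝ) r (h n)) ∧
      (∀ n, Function.support (h n) ⊆ V n) ∧ ∀ x, ∑ᶠ n, h n x = 1 := by
  have : LocallyCompactSpace M := ChartedSpace.locallyCompactSpace EM M
  -- The shrunken sets `A n` still cover, so the sum of the `g n` is positive everywhere and can be
  -- divided by.
  obtain ⟨A, hAu, hAc, hAV⟩ := exists_iUnion_eq_closed_subset hV.isOpen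
    (fun x => hV.locallyFinite.point_finite x) hV.iUnion_eq
  have hA : ∀ n, IsCompact (A n) := fun n =>
    (hV.isCompact_closure n).of_isClosed_subset (hAc n) ((hAV n).trans subset_closure)
  choose g hg hg0 hgA hgV using fun n =>
    exists_contMDiff_pos_on_compact (EM := EM) r (hA n) (hV.isOpen n) (hAV n)
  have hlf : LocallyFinite fun n => Function.support (g n) := hV.locallyFinite.subset hgV
  have hfin : ∀ x, (Function.support fun n => g n x).Finite := fun x => hlf.point_finite x
  have hs : ContMDiff 𝓘(ℝ, EM) 𝓘(ℝ, ℝ) r fun x => ∑ᶠ n, g n x := contMDiff_finsum hg hlf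
  have hpos : ∀ x, 0 < ∑ᶠ n, g n x := fun x => by
    obtain ⟨n, hn⟩ := mem_iUnion.1 (hAu ▸ mem_univ x : x ∈ ⋃ n, A n)
    exact finsum_pos (fun n => hg0 n x) ⟨n, hgA n x hn⟩ (hfin x)
  refine ⟨fun n x => g n x / ∑ᶠ m, g m x, fun n => (hg n).div₀ hs fun x => (hpos x).ne',
    fun n x hx => hgV n fun h => hx (by simp [h]), fun x => ?_⟩
  simp only [div_eq_mul_inv]
  rw [← finsum_mul, mul_inv_cancel₀ (hpos x).ne']

end Bump

section Plateau

variable {EM : Type*} [NormedAddCommGroup EM] [NormedSpace ℝ EM] [FiniteDimensional ℝ EM]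
  {M : Type*} [TopologicalSpace M] [ChartedSpace EM M] [T2Space M] [SigmaCompactSpace M]

/-- For a locally finite cover `(U n)` by relatively compact open sets, there are compactly
supported `C^r`-functions `χ n` with `χ n = 1` on `U n`, such that every compact set meets the
support of only finitely many `χ n`. -/
theorem IsLocFinRelCompactCover.exists_plateau (r : ℕ∞)
    [IsManifold 𝓘(ℝ, EM) (r : WithTop ℕ∞) M] {U : ℕ → Set M} (hU : IsLocFinRelCompactCover U) :
    ∃ χ : ℕ → M → ℝ, (∀ n, ContMDiff 𝓘(ℝ, EM) 𝓘(ℝ, ℝ) r (χ n)) ∧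
      (∀ n, IsCompact (tsupport (χ n))) ∧ (∀ n, ∀ x ∈ U n, χ n x = 1) ∧
      ∀ K : Set M, IsCompact K → {n | (Function.support (χ n) ∩ K).Nonempty}.Finite := by
  obtain ⟨ρ, hρ, hρU, hρ1⟩ := hU.exists_partition (EM := EM) r
  -- `χ n` is the sum of those `ρ m` whose `U m` meets `closure (U n)`; on `U n` every other `ρ m`
  -- vanishes, so the sum is `1` there.
  have hJ : ∀ n, {m | (U m ∩ closure (U n)).Nonempty}.Finite := fun n =>
    hU.locallyFinite.finite_nonempty_inter_compact (hU.isCompact_closure n)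
  have hsupp : ∀ n x, (∑ m ∈ (hJ n).toFinset, ρ m x) ≠ 0 →
      ∃ m, (U m ∩ closure (U n)).Nonempty ∧ x ∈ U m := fun n x hx => by
    obtain ⟨m, hm, hxm⟩ := Finset.exists_ne_zero_of_sum_ne_zero hx
    exact ⟨m, by simpa using hm, hρU m hxm⟩
  refine ⟨fun n x => ∑ m ∈ (hJ n).toFinset, ρ m x, fun n => contMDiff_finsetSum fun m _ => hρ m,
    fun n => ?_, fun n x hx => ?_, fun K hK => ?_⟩
  · have hc : IsCompact (⋃ m ∈ {m | (U m ∩ closure (U n)).Nonempty}, closure (U m)) :=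
      (hJ n).isCompact_biUnion fun m _ => hU.isCompact_closure m
    refine hc.of_isClosed_subset (isClosed_tsupport _) (closure_minimal ?_ hc.isClosed)
    intro x hx
    obtain ⟨m, hm, hxm⟩ := hsupp n x hx
    exact mem_biUnion hm (subset_closure hxm)
  · rw [← hρ1 x]
    refine (finsum_eq_sum_of_support_subset _ fun m hm => ?_).symm
    have hxm : x ∈ U m := hρU m hm
    simpa using ⟨x, hxm, subset_closure hx⟩
  · have h1 := hU.locallyFinite.finite_nonempty_inter_compact hK
    have h2 : ∀ m, {n | (closure (U n) ∩ closure (U m)).Nonempty}.Finite := fun m =>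
      hU.locallyFinite.closure.finite_nonempty_inter_compact (hU.isCompact_closure m)
    refine (h1.biUnion fun m _ => h2 m).subset ?_
    rintro n ⟨x, hx, hxK⟩
    obtain ⟨m, ⟨z, hz, hzn⟩, hxm⟩ := hsupp n x hx
    exact mem_biUnion (⟨x, hxm, hxK⟩ : m ∈ {n | (U n ∩ K).Nonempty})
      ⟨z, hzn, subset_closure hz⟩

end Plateau

/-! ### The vector topology given by one gauge. -/

section GaugeTopology

open scoped Pointwise

variable {Z : Type*} [AddCommGroup Z] [Module ℝ Z] {Q : Set Z}

/-- For an absolutely convex, absorbent set `Q`, the positive multiples of `Q` form a basis of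
zero-neighbourhoods of a locally convex vector topology. -/
theorem AbsConvex.exists_locallyConvex_topology (hQ : AbsConvex ℝ Q) (hQa : Absorbent ℝ Q) :
    ∃ τ : TopologicalSpace Z, @IsTopologicalAddGroup Z τ _ ∧ @ContinuousSMul ℝ Z _ _ τ ∧
      @LocallyConvexSpace ℝ Z _ _ _ _ τ ∧ Q ∈ @nhds Z τ 0 ∧
      ∀ U ∈ @nhds Z τ 0, ∃ c : ℝ, c ≠ 0 ∧ c • Q ⊆ U := by
  let p : SeminormFamily ℝ Z Unit := fun _ => gaugeSeminorm hQ.1 hQ.2 hQa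
  let τ : TopologicalSpace Z := p.moduleFilterBasis.topology
  have hp : WithSeminorms p := ⟨rfl⟩
  refine ⟨τ, hp.topologicalAddGroup, hp.continuousSMul, hp.toLocallyConvexSpace, ?_,
    fun U hU => ?_⟩
  · refine (hp.mem_nhds_iff 0 Q).2 ⟨{()}, 1, one_pos, fun x hx => ?_⟩
    rw [Finset.sup_singleton, Seminorm.mem_ball, sub_zero] at hx
    exact setOfPred_gauge_lt_one_subset_self hQ.2 hQa.zero_mem hQa hx
  -- The factor `ε / 2` yields the strict bound `gauge Q x < ε` on the multiple of `Q`.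
  · obtain ⟨s, ε, hε, hs⟩ := (hp.mem_nhds_iff 0 U).1 hU
    refine ⟨ε / 2, (half_pos hε).ne', fun x hx => hs ?_⟩
    have hx' : gauge Q x < ε := (gauge_le_of_mem (half_pos hε).le hx).trans_lt (half_lt_self hε)
    rw [Seminorm.mem_ball, sub_zero]
    exact Seminorm.finset_sup_apply_lt hε fun i _ => hx'

end GaugeTopology

/-! ### The steps `C^r_K(M,E)`. -/

section TestMapIn

variable {r : ℕ∞} {EM : Type*} [NormedAddCommGroup EM] [NormedSpace ℝ EM]
  {M : Type*} [TopologicalSpace M] [ChartedSpace EM M]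
  {E : Type*} [AddCommGroup E] [Module ℝ E] [TopologicalSpace E]
  [IsTopologicalAddGroup E] [T2Space E]

namespace TestMapIn

@[ext] theorem ext {K : Compacts M} {γ η : TestMapIn r EM M E K} (h : ∀ x, γ x = η x) : γ = η :=
  Subtype.ext (funext h)

section Linear

/-- `γ ↦ d^k(γ ∘ φ⁻¹)` as a linear map. -/
def chartDerivₗ (𝕜 : Type*) [Semiring 𝕜] [Module 𝕜 E] [SMulCommClass ℝ 𝕜 E]
    [ContinuousConstSMul 𝕜 E] (K : Compacts M) {φ : OpenPartialHomeomorph M EM}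
    (hφ : φ ∈ IsManifold.maximalAtlas 𝓘(ℝ, EM) (r : WithTop ℕ∞) M) {k : ℕ} (hk : (k : ℕ∞) ≤ r) :
    TestMapIn r EM M E K →ₗ[𝕜] C(φ.target × (Fin k → EM), E) where
  toFun γ := chartDeriv γ.2.1 hφ hk
  map_add' γ η := by
    ext p
    exact ((γ.2.1 φ hφ).iterDirDeriv_add φ.open_target (η.2.1 φ hφ) k hk p.2 p.1.2).symm
  map_smul' c γ := by
    ext p
    exact ((γ.2.1 φ hφ).iterDirDeriv_map (L := DistribSMul.toAddMonoidHom E c) φ.open_target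
      (continuous_const_smul c) (fun a w => (smul_comm a c w).symm) k hk p.2 p.1.2).symm

variable {𝕜 : Type*} [Semiring 𝕜] [TopologicalSpace 𝕜] [Module 𝕜 E] [SMulCommClass ℝ 𝕜 E]
  [ContinuousSMul 𝕜 E]

instance (K : Compacts M) : ContinuousSMul 𝕜 (TestMapIn r EM M E K) :=
  continuousSMul_iInf fun _ => continuousSMul_iInf fun hφ => continuousSMul_iInf fun _ =>
    continuousSMul_iInf fun hk => continuousSMul_induced (chartDerivₗ 𝕜 K hφ hk)

end Linear

variable [ContinuousSMul ℝ E]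

instance (K : Compacts M) : IsTopologicalAddGroup (TestMapIn r EM M E K) :=
  topologicalAddGroup_iInf fun _ => topologicalAddGroup_iInf fun hφ =>
    topologicalAddGroup_iInf fun _ => topologicalAddGroup_iInf fun hk =>
      topologicalAddGroup_induced (chartDerivₗ ℝ K hφ hk)

instance [LocallyConvexSpace ℝ E] (K : Compacts M) :
    LocallyConvexSpace ℝ (TestMapIn r EM M E K) :=
  .iInf fun _ => .iInf fun hφ => .iInf fun _ => .iInf fun hk => .induced (chartDerivₗ ℝ K hφ hk)

theorem continuous_chartDeriv (K : Compacts M) {φ : OpenPartialHomeomorph M EM}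
    (hφ : φ ∈ IsManifold.maximalAtlas 𝓘(ℝ, EM) (r : WithTop ℕ∞) M) {k : ℕ} (hk : (k : ℕ∞) ≤ r) :
    Continuous fun γ : TestMapIn r EM M E K => chartDeriv γ.2.1 hφ hk :=
  continuous_iInf_dom (i := φ) <| continuous_iInf_dom (i := hφ) <| continuous_iInf_dom (i := k) <|
    continuous_iInf_dom (i := hk) continuous_induced_dom

theorem continuous_iff {Z : Type*} [TopologicalSpace Z] {K : Compacts M}
    {g : Z → TestMapIn r EM M E K} : Continuous g ↔ ∀ (φ : OpenPartialHomeomorph M EM)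
    (hφ : φ ∈ IsManifold.maximalAtlas 𝓘(ℝ, EM) (r : WithTop ℕ∞) M) (k : ℕ) (hk : (k : ℕ∞) ≤ r),
    Continuous fun z => chartDeriv (g z).2.1 hφ hk := by
  simp only [continuous_iInf_rng, continuous_induced_rng]
  rfl

theorem continuous_apply [IsManifold 𝓘(ℝ, EM) (r : WithTop ℕ∞) M] (K : Compacts M) (x : M) :
    Continuous fun γ : TestMapIn r EM M E K => γ x := by
  have h := (ContinuousEvalConst.continuous_eval_const
    (⟨⟨chartAt EM x x, mem_chart_target EM x⟩, Fin.elim0⟩ :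
      (chartAt EM x).target × (Fin 0 → EM))).comp (continuous_chartDeriv (r := r) (E := E) K
    (IsManifold.chart_mem_maximalAtlas (I := 𝓘(ℝ, EM)) x) (k := 0) (zero_le))
  refine h.congr fun γ => ?_
  exact congrArg γ ((chartAt EM x).left_inv (mem_chart_source EM x))

end TestMapIn

theorem IsCkMap.smul [ContinuousSMul ℝ E] {χ : M → ℝ} (hχ : ContMDiff 𝓘(ℝ, EM) 𝓘(ℝ, ℝ) r χ)
    {γ : M → E} (hγ : IsCkMap r EM γ) : IsCkMap r EM fun x => χ x • γ x :=
  fun φ hφ => (hχ.isCkOn_comp_symm hφ).smul φ.open_target (hγ φ hφ)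

end TestMapIn

/-! ### The direct limit `C^r_c(M,E)`. -/

section TestMap

variable {r : ℕ∞} {EM : Type*} [NormedAddCommGroup EM] [NormedSpace ℝ EM]
  {M : Type*} [TopologicalSpace M] [R1Space M] [ChartedSpace EM M]
  {E : Type*} [AddCommGroup E] [Module ℝ E] [TopologicalSpace E]
  [IsTopologicalAddGroup E] [T2Space E] [ContinuousSMul ℝ E]

namespace TestMap

@[ext] theorem ext {γ η : TestMap r EM M E} (h : ∀ x, γ x = η x) : γ = η :=
  Subtype.ext (funext h)

theorem add_apply (γ η : TestMap r EM M E) (x : M) : (γ + η) x = γ x + η x := rfl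

theorem smul_apply {𝕜 : Type*} [Semiring 𝕜] [Module 𝕜 E] [SMulCommClass ℝ 𝕜 E]
    [ContinuousConstSMul 𝕜 E] (c : 𝕜) (γ : TestMap r EM M E) (x : M) : (c • γ) x = c • γ x := rfl

/-- Evaluation at a point as a linear map. -/
def evalₗ (𝕜 : Type*) [Semiring 𝕜] [Module 𝕜 E] [SMulCommClass ℝ 𝕜 E]
    [ContinuousConstSMul 𝕜 E] (x : M) : TestMap r EM M E →ₗ[𝕜] E where
  toFun γ := γ x
  map_add' _ _ := rfl
  map_smul' _ _ := rfl

/-- The inclusion map `C^r_K(M,E) → C^r_c(M,E)` as a linear map. -/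
def inclₗ (𝕜 : Type*) [Semiring 𝕜] [Module 𝕜 E] [SMulCommClass ℝ 𝕜 E]
    [ContinuousConstSMul 𝕜 E] (K : Compacts M) : TestMapIn r EM M E K →ₗ[𝕜] TestMap r EM M E where
  toFun γ := γ.incl
  map_add' _ _ := rfl
  map_smul' _ _ := rfl

/-- Smaller topologies are finer in this order, and the defining properties pass to infima; so the
infimum belongs to its own family. -/
instance : IsTopologicalAddGroup (TestMap r EM M E) :=
  topologicalAddGroup_sInf fun _ h => h.2.1

instance : ContinuousSMul ℝ (TestMap r EM M E) :=
  continuousSMul_sInf fun _ h => h.2.2.1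

instance : LocallyConvexSpace ℝ (TestMap r EM M E) :=
  .sInf fun _ h => h.2.2.2

theorem continuous_incl (K : Compacts M) :
    Continuous (TestMapIn.incl : TestMapIn r EM M E K → TestMap r EM M E) :=
  continuous_sInf_rng.2 fun _ h => h.1 K

/-- The universal property of the locally convex direct limit. -/
theorem continuous_of_continuous_incl {Z : Type*} [AddCommGroup Z] [Module ℝ Z]
    [TopologicalSpace Z] [IsTopologicalAddGroup Z] [ContinuousSMul ℝ Z] [LocallyConvexSpace ℝ Z]
    (T : TestMap r EM M E →ₗ[ℝ] Z)
    (h : ∀ K : Compacts M, Continuous fun γ : TestMapIn r EM M E K => T γ.incl) :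
    Continuous T :=
  continuous_iff_le_induced.2 <| sInf_le ⟨fun K => continuous_induced_rng.2 (h K),
    topologicalAddGroup_induced T, continuousSMul_induced T, LocallyConvexSpace.induced T⟩

/-- A test map as an element of `C^r_K(M,E)`, for a compact set `K` containing its support. -/
def restrict (γ : TestMap r EM M E) (K : Compacts M) (h : tsupport γ ⊆ K) :
    TestMapIn r EM M E K := ⟨γ.1, γ.2.1, h⟩

/-- The support of a test map. -/
def compacts (γ : TestMap r EM M E) : Compacts M := ⟨tsupport γ, γ.2.2⟩

/-- An absolutely convex subset of the direct limit is a zero-neighbourhood if its preimages in the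
steps are zero-neighbourhoods. -/
theorem mem_nhds_zero_of_absConvex {Q : Set (TestMap r EM M E)} (hQ : AbsConvex ℝ Q)
    (h : ∀ K : Compacts M, TestMapIn.incl ⁻¹' Q ∈ 𝓝 (0 : TestMapIn r EM M E K)) :
    Q ∈ 𝓝 (0 : TestMap r EM M E) := by
  have hQa : Absorbent ℝ Q := absorbent_iff_eventually_nhdsNE_zero.2 fun γ => by
    have hc : Tendsto (fun c : ℝ => c • γ.restrict γ.compacts Subset.rfl) (𝓝 0) (𝓝 0) := by
      have : Continuous fun c : ℝ => c • γ.restrict γ.compacts Subset.rfl := by fun_prop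
      simpa using this.tendsto 0
    exact nhdsWithin_le_nhds (hc (h γ.compacts))
  obtain ⟨τ, h1, h2, h3, hQτ, hb⟩ := hQ.exists_locallyConvex_topology hQa
  have hc : ∀ K : Compacts M, @Continuous _ _ _ τ
      (TestMapIn.incl : TestMapIn r EM M E K → TestMap r EM M E) := fun K => by
    refine @continuous_of_continuousAt_zero _ _ _ _ _ _ _ τ h1.toContinuousAdd _ _
      (inclₗ ℝ K) fun U hU => ?_
    rw [map_zero] at hU
    rw [mem_map]
    obtain ⟨c, hc, hcU⟩ := hb U hU
    filter_upwards [(set_smul_mem_nhds_zero_iff hc).2 (h K)] with γ hγ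
    obtain ⟨η, hη, rfl⟩ := hγ
    exact hcU ⟨_, hη, rfl⟩
  -- `τ` is a member of the family whose infimum is the limit topology, so the latter is finer.
  refine Filter.le_def.1 (_root_.nhds_mono ?_) Q hQτ
  exact sInf_le ⟨hc, h1, h2, h3⟩

theorem continuous_apply [LocallyConvexSpace ℝ E] [IsManifold 𝓘(ℝ, EM) (r : WithTop ℕ∞) M]
    (x : M) : Continuous fun γ : TestMap r EM M E => γ x :=
  continuous_of_continuous_incl (evalₗ ℝ x) fun K => TestMapIn.continuous_apply K x

/-- Multiplication with a `C^r`-function that is supported in `K`. -/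
def mulₗ (𝕜 : Type*) [Semiring 𝕜] [Module 𝕜 E] [SMulCommClass ℝ 𝕜 E]
    [ContinuousConstSMul 𝕜 E] {χ : M → ℝ} (hχ : ContMDiff 𝓘(ℝ, EM) 𝓘(ℝ, ℝ) r χ) (K : Compacts M)
    (hK : tsupport χ ⊆ K) : TestMap r EM M E →ₗ[𝕜] TestMapIn r EM M E K where
  toFun γ := ⟨fun x => χ x • γ x, γ.2.1.smul hχ, (tsupport_smul_subset_left χ γ).trans hK⟩
  map_add' γ η := TestMapIn.ext fun x => smul_add (χ x) (γ x) (η x)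
  map_smul' c γ := TestMapIn.ext fun x => smul_comm (χ x) c (γ x)

theorem mulₗ_apply (𝕜 : Type*) [Semiring 𝕜] [Module 𝕜 E] [SMulCommClass ℝ 𝕜 E]
    [ContinuousConstSMul 𝕜 E] {χ : M → ℝ} (hχ : ContMDiff 𝓘(ℝ, EM) 𝓘(ℝ, ℝ) r χ) (K : Compacts M)
    (hK : tsupport χ ⊆ K) (γ : TestMap r EM M E) (x : M) : mulₗ 𝕜 hχ K hK γ x = χ x • γ x := rfl

/-- Continuity into a compact-open space follows from joint continuity after uncurrying. The Leibniz
formula reduces this to joint continuity of evaluating `chartDeriv`, which holds because `φ.target ×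
EM^k` is locally compact. -/
theorem continuous_mulₗ_incl [FiniteDimensional ℝ EM] {χ : M → ℝ}
    (hχ : ContMDiff 𝓘(ℝ, EM) 𝓘(ℝ, ℝ) r χ) (K : Compacts M) (hK : tsupport χ ⊆ K)
    (L : Compacts M) : Continuous fun γ : TestMapIn r EM M E L => mulₗ ℝ hχ K hK γ.incl := by
  refine TestMapIn.continuous_iff.2 fun φ hφ k hk => ?_
  have : LocallyCompactSpace φ.target := φ.open_target.locallyCompactSpace
  have hχφ := hχ.isCkOn_comp_symm hφ
  refine ContinuousMap.continuous_of_continuous_uncurry _ ?_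
  have hsum : Continuous fun p : TestMapIn r EM M E L × (φ.target × (Fin k → EM)) =>
      ((Splitting.all k).map (Splitting.term (χ ∘ φ.symm) (p.1 ∘ φ.symm) p.2.2 p.2.1)).sum := by
    refine continuous_list_sum (f := fun S (p : TestMapIn r EM M E L × (φ.target × (Fin k → EM))) =>
      Splitting.term (χ ∘ φ.symm) (p.1 ∘ φ.symm) p.2.2 p.2.1 S) _ fun S hS => ?_
    obtain ⟨hi, hj⟩ := Splitting.le_of_mem_all hS
    have hi' : (S.i : ℕ∞) ≤ r := (by exact_mod_cast hi : (S.i : ℕ∞) ≤ k).trans hk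
    have hj' : (S.j : ℕ∞) ≤ r := (by exact_mod_cast hj : (S.j : ℕ∞) ≤ k).trans hk
    have hσ : ∀ {i : ℕ} (σ : Fin i → Fin k), Continuous
        fun p : TestMapIn r EM M E L × (φ.target × (Fin k → EM)) => p.2.2 ∘ σ := fun σ =>
      continuous_pi fun j => (_root_.continuous_apply (σ j)).comp (by fun_prop)
    refine Continuous.smul ?_ ?_
    · exact (hχφ.continuousOn S.i hi').comp_continuous
        (f := fun p : TestMapIn r EM M E L × (φ.target × (Fin k → EM)) =>
          ((p.2.1 : EM), p.2.2 ∘ S.left))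
        ((continuous_subtype_val.comp (by fun_prop)).prodMk (hσ _))
        fun p => ⟨p.2.1.2, mem_univ _⟩
    · exact continuous_eval.comp (((TestMapIn.continuous_chartDeriv L hφ hj').comp
        continuous_fst).prodMk ((continuous_fst.comp continuous_snd).prodMk (hσ S.right)))
  refine hsum.congr fun p => ?_
  exact (hχφ.iterDirDeriv_smul φ.open_target (p.1.2.1 φ hφ) hk p.2.2 p.2.1.2).symm

theorem continuous_mulₗ [FiniteDimensional ℝ EM] [LocallyConvexSpace ℝ E] {χ : M → ℝ}
    (hχ : ContMDiff 𝓘(ℝ, EM) 𝓘(ℝ, ℝ) r χ) (K : Compacts M) (hK : tsupport χ ⊆ K) :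
    Continuous (mulₗ ℝ hχ K hK : TestMap r EM M E →ₗ[ℝ] TestMapIn r EM M E K) :=
  continuous_of_continuous_incl _ (continuous_mulₗ_incl hχ K hK)

end TestMap

end TestMap

/-! ### Directional derivatives along linear maps. -/

section DirDeriv

variable {𝕜 : Type*} [NontriviallyNormedField 𝕜]
  {X X' Y : Type*} [AddCommGroup X] [Module 𝕜 X] [AddCommGroup X'] [Module 𝕜 X']
  [AddCommGroup Y] [Module 𝕜 Y] [TopologicalSpace Y]

theorem hasDirDeriv_dirDeriv {f : X → Y} {x v : X} (h : ∃ d, HasDirDeriv 𝕜 f x v d) :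
    HasDirDeriv 𝕜 f x v (dirDeriv 𝕜 f x v) := by
  unfold dirDeriv
  rw [dif_pos h]
  exact h.choose_spec

theorem hasDirDeriv_comp_linearMap (L : X' →ₗ[𝕜] X) (f : X → Y) (x v : X') (d : Y) :
    HasDirDeriv 𝕜 (fun z => f (L z)) x v d ↔ HasDirDeriv 𝕜 f (L x) (L v) d := by
  simp only [HasDirDeriv, map_add, map_smul]

/-- Both sides choose from the same predicate, so they agree even when the derivative does not
exist. Continuity of `L` plays no role. -/
theorem dirDeriv_comp_linearMap (L : X' →ₗ[𝕜] X) (f : X → Y) (x v : X') :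
    dirDeriv 𝕜 (fun z => f (L z)) x v = dirDeriv 𝕜 f (L x) (L v) := by
  have h : HasDirDeriv 𝕜 (fun z => f (L z)) x v = HasDirDeriv 𝕜 f (L x) (L v) :=
    funext fun d => propext (hasDirDeriv_comp_linearMap L f x v d)
  unfold dirDeriv
  rw [h]

theorem iterDirDeriv_comp_linearMap (L : X' →ₗ[𝕜] X) (f : X → Y) (k : ℕ) (y : Fin k → X')
    (x : X') : iterDirDeriv 𝕜 (fun z => f (L z)) k y x = iterDirDeriv 𝕜 f k (L ∘ y) (L x) := by
  induction k generalizing x with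
  | zero => rfl
  | succ k ih =>
    have e : iterDirDeriv 𝕜 (fun z => f (L z)) k (Fin.init y) =
        fun z => iterDirDeriv 𝕜 f k (L ∘ Fin.init y) (L z) := funext (ih _)
    simp only [iterDirDeriv, e, dirDeriv_comp_linearMap]
    rfl

end DirDeriv

/-! ### Almost local maps. -/

section AlmostLocal

variable {r s : ℕ∞}
  {EM : Type*} [NormedAddCommGroup EM] [NormedSpace ℝ EM]
  {EN : Type*} [NormedAddCommGroup EN] [NormedSpace ℝ EN]
  {M : Type*} [TopologicalSpace M] [T2Space M] [ChartedSpace EM M]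
  {N : Type*} [TopologicalSpace N] [T2Space N] [ChartedSpace EN N]
  {E : Type*} [AddCommGroup E] [Module ℝ E] [TopologicalSpace E]
  [IsTopologicalAddGroup E] [T2Space E] [ContinuousSMul ℝ E]
  {F : Type*} [AddCommGroup F] [Module ℝ F] [TopologicalSpace F]
  [IsTopologicalAddGroup F] [T2Space F] [ContinuousSMul ℝ F] [LocallyConvexSpace ℝ F]

theorem TestMap.exists_compacts_tsupport_subset {k : ℕ} (x : TestMap r EM M E)
    (y : Fin k → TestMap r EM M E) :
    ∃ K : Compacts M, tsupport x ⊆ K ∧ ∀ i, tsupport (y i) ⊆ K := by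
  refine ⟨x.compacts ⊔ ⟨⋃ i, tsupport (y i), isCompact_iUnion fun i => (y i).2.2⟩, ?_, fun i => ?_⟩
  · exact subset_union_left
  · exact (subset_iUnion (fun i => tsupport (y i)) i).trans subset_union_right

section Scalars

variable {𝕜 : Type*} [RCLike 𝕜] [Module 𝕜 E] [SMulCommClass ℝ 𝕜 E] [ContinuousSMul 𝕜 E]
  [Module 𝕜 F] [SMulCommClass ℝ 𝕜 F] [ContinuousSMul 𝕜 F]

/-- For scalars in `𝕜`, continuity of scalar multiplication is available on the steps, so the line
is parametrised inside the step of `v`. -/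
theorem TestMap.eventually_add_smul_mem {Ω : Set (TestMap r EM M E)} (hΩ : IsOpen Ω)
    {x : TestMap r EM M E} (hx : x ∈ Ω) (v : TestMap r EM M E) :
    ∀ᶠ h : 𝕜 in 𝓝[≠] 0, x + h • v ∈ Ω := by
  have hc : Continuous fun h : 𝕜 => x + (h • v.restrict v.compacts Subset.rfl).incl :=
    continuous_const.add ((continuous_incl _).comp (by fun_prop))
  refine nhdsWithin_le_nhds (hc.continuousAt.preimage_mem_nhds (hΩ.mem_nhds ?_))
  rw [zero_smul]
  exact (add_zero x).symm ▸ hx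

/-- The iterated directional derivatives of an almost local map are almost local. -/
theorem TestMap.eqOn_iterDirDeriv [IsManifold 𝓘(ℝ, EN) (s : WithTop ℕ∞) N]
    {Ω : Set (TestMap r EM M E)} (hΩ : IsOpen Ω) {f : TestMap r EM M E → TestMap s EN N F}
    {t : ℕ∞} (hd : ∀ k : ℕ, (k : ℕ∞) < t → ∀ y : Fin k → TestMap r EM M E, ∀ x ∈ Ω, ∀ v,
      ∃ d, HasDirDeriv 𝕜 (iterDirDeriv 𝕜 f k y) x v d)
    {U : Set M} {V : Set N} (hf : ∀ γ ∈ Ω, ∀ η ∈ Ω, EqOn γ η U → EqOn (f γ) (f η) V)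
    {k : ℕ} (hk : (k : ℕ∞) ≤ t) {y y' : Fin k → TestMap r EM M E}
    (hy : ∀ i, EqOn (y i) (y' i) U) {x x' : TestMap r EM M E} (hx : x ∈ Ω) (hx' : x' ∈ Ω)
    (h : EqOn x x' U) :
    EqOn (iterDirDeriv 𝕜 f k y x : TestMap s EN N F)
      (iterDirDeriv 𝕜 f k y' x' : TestMap s EN N F) V := by
  induction k generalizing x x' with
  | zero => exact hf x hx x' hx' h
  | succ k ih =>
    intro p hp
    have hk' : (k : ℕ∞) < t := lt_of_lt_of_le (by exact_mod_cast Nat.lt_succ_self k) hk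
    -- Evaluation at `p` is continuous, so the derivative at `p` is a limit of difference quotients
    -- in `F`; by induction these agree for the two families once both lines lie in `Ω`.
    have key : ∀ {y : Fin (k + 1) → TestMap r EM M E} {x : TestMap r EM M E}, x ∈ Ω →
        Tendsto (fun h : 𝕜 => h⁻¹ • (iterDirDeriv 𝕜 f k (Fin.init y) (x + h • y (Fin.last k)) p -
          iterDirDeriv 𝕜 f k (Fin.init y) x p)) (𝓝[≠] 0) (𝓝 (iterDirDeriv 𝕜 f (k + 1) y x p)) :=
      fun {y x} hx => ((continuous_apply p).tendsto _).comp
        (hasDirDeriv_dirDeriv (hd k hk' (Fin.init y) x hx (y (Fin.last k))))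
    refine tendsto_nhds_unique_of_eventuallyEq (key hx) (key hx') ?_
    filter_upwards [eventually_add_smul_mem hΩ hx (y (Fin.last k)),
      eventually_add_smul_mem hΩ hx' (y' (Fin.last k))] with c hc hc'
    have h1 : EqOn (x + c • y (Fin.last k) : TestMap r EM M E)
        (x' + c • y' (Fin.last k) : TestMap r EM M E) U := fun z hz => by
      rw [add_apply, add_apply, smul_apply, smul_apply, h hz, hy _ hz]
    have hy' : ∀ i, EqOn (Fin.init y i : TestMap r EM M E) (Fin.init y' i : TestMap r EM M E) U :=
      fun i => hy i.castSucc
    exact congrArg (c⁻¹ • ·)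
      (congrArg₂ (· - ·) (ih hk'.le hy' hc hc' h1 hp) (ih hk'.le hy' hx hx' h hp))

theorem TestMap.exists_hasDirDeriv {Y : Type*} [AddCommGroup Y] [Module 𝕜 Y] [TopologicalSpace Y]
    {Ω : Set (TestMap r EM M E)} {f : TestMap r EM M E → Y} {t : ℕ∞}
    (hK : ∀ K : Compacts M,
      IsCkOn 𝕜 t (fun γ : TestMapIn r EM M E K => f γ.incl) (TestMapIn.incl ⁻¹' Ω))
    {k : ℕ} (hk : (k : ℕ∞) < t) (y : Fin k → TestMap r EM M E) {x : TestMap r EM M E} (hx : x ∈ Ω)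
    (v : TestMap r EM M E) : ∃ d, HasDirDeriv 𝕜 (iterDirDeriv 𝕜 f k y) x v d := by
  obtain ⟨K, hxK, hyK⟩ := exists_compacts_tsupport_subset x
    (Fin.snoc (α := fun _ => TestMap r EM M E) y v)
  have hy : ∀ i, tsupport (y i) ⊆ K := fun i => by simpa using hyK i.castSucc
  have hv : tsupport v ⊆ K := by simpa using hyK (Fin.last k)
  obtain ⟨d, h⟩ := (hK K).exists_deriv k hk (fun i => (y i).restrict K (hy i)) (x.restrict K hxK)
    hx (v.restrict K hv)
  have e : iterDirDeriv 𝕜 (fun γ : TestMapIn r EM M E K => f γ.incl) k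
      (fun i => (y i).restrict K (hy i)) = fun γ => iterDirDeriv 𝕜 f k y (inclₗ 𝕜 K γ) :=
    funext (iterDirDeriv_comp_linearMap (inclₗ 𝕜 K) f k _)
  rw [e, hasDirDeriv_comp_linearMap (inclₗ 𝕜 K)] at h
  exact ⟨d, h⟩

end Scalars

theorem exists_mem_nhds_forall_mem_of_mem_nhds_pi {A : Type*} [TopologicalSpace A] {k : ℕ} {a : A}
    {v : Set (Fin k → A)} (hv : v ∈ 𝓝 fun _ : Fin k => a) :
    ∃ w ∈ 𝓝 a, ∀ y : Fin k → A, (∀ i, y i ∈ w) → y ∈ v := by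
  rw [nhds_pi, Filter.mem_pi] at hv
  obtain ⟨I, -, t, ht, hI⟩ := hv
  exact ⟨⋂ i, t i, iInter_mem.2 ht, fun y hy => hI fun i _ => mem_iInter.1 (hy i) i⟩

variable [LocallyConvexSpace ℝ E]

/-- Given plateau functions `χ n`, a sequence of absolutely convex zero-neighbourhoods `P n` in the
steps yields a zero-neighbourhood in the direct limit. -/
theorem TestMap.setOf_forall_mulₗ_mem_nhds_zero [FiniteDimensional ℝ EM] {χ : ℕ → M → ℝ}
    (hχ : ∀ n, ContMDiff 𝓘(ℝ, EM) 𝓘(ℝ, ℝ) r (χ n))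
    (hχK : ∀ K : Set M, IsCompact K → {n | (Function.support (χ n) ∩ K).Nonempty}.Finite)
    (K : ℕ → Compacts M) (hK : ∀ n, tsupport (χ n) ⊆ K n)
    {P : ∀ n, Set (TestMapIn r EM M E (K n))} (hP : ∀ n, P n ∈ 𝓝 0)
    (hPc : ∀ n, AbsConvex ℝ (P n)) :
    {z | ∀ n, mulₗ ℝ (hχ n) (K n) (hK n) z ∈ P n} ∈ 𝓝 (0 : TestMap r EM M E) := by
  refine mem_nhds_zero_of_absConvex ⟨?_, ?_⟩ fun L => ?_
  · rintro a ha _ ⟨z, hz, rfl⟩ n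
    change mulₗ ℝ (hχ n) (K n) (hK n) (a • z) ∈ P n
    rw [map_smul]
    exact (hPc n).1 a ha ⟨_, hz n, rfl⟩
  · intro z hz w hw a b ha hb hab n
    rw [map_add, map_smul, map_smul]
    exact (hPc n).2 (hz n) (hw n) ha hb hab
  · have h : ∀ n, {γ : TestMapIn r EM M E L | mulₗ ℝ (hχ n) (K n) (hK n) γ.incl ∈ P n} ∈
        𝓝 (0 : TestMapIn r EM M E L) := fun n => by
      refine (continuous_mulₗ_incl (hχ n) (K n) (hK n) L).continuousAt.preimage_mem_nhds ?_
      have e : mulₗ ℝ (hχ n) (K n) (hK n) (0 : TestMapIn r EM M E L).incl = 0 :=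
        map_zero (mulₗ ℝ (hχ n) (K n) (hK n))
      rw [e]
      exact hP n
    -- Only the finitely many `χ n` whose support meets `L` impose a condition; the other products
    -- are zero.
    filter_upwards [(biInter_mem (hχK L L.isCompact)).2 fun n _ => h n] with γ hγ n
    by_cases hn : (Function.support (χ n) ∩ L).Nonempty
    · exact mem_iInter₂.1 hγ n hn
    · have e : mulₗ ℝ (hχ n) (K n) (hK n) γ.incl = 0 := TestMapIn.ext fun x => by
        rw [mulₗ_apply]
        by_cases hx : χ n x = 0
        · rw [hx, zero_smul]; rfl
        · have hxL : x ∉ tsupport γ := fun h => hn ⟨x, hx, γ.2.2 h⟩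
          change χ n x • γ x = 0
          rw [image_eq_zero_of_notMem_tsupport hxL, smul_zero]
      rw [e]
      exact mem_of_mem_nhds (hP n)

/-- A test map is the finite sum of its products with the functions of a partition of unity. -/
theorem TestMap.exists_eq_sum_mulₗ {V : ℕ → Set N} (hV : IsLocFinRelCompactCover V)
    {h : ℕ → N → ℝ} (hh : ∀ n, ContMDiff 𝓘(ℝ, EN) 𝓘(ℝ, ℝ) s (h n))
    (hhV : ∀ n, Function.support (h n) ⊆ V n) (hh1 : ∀ x, ∑ᶠ n, h n x = 1)
    (L : ℕ → Compacts N) (hL : ∀ n, tsupport (h n) ⊆ L n) (w : TestMap s EN N F) :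
    ∃ J : Finset ℕ, w = ∑ n ∈ J, inclₗ ℝ (L n) (mulₗ ℝ (hh n) (L n) (hL n) w) := by
  have hfin := hV.locallyFinite.finite_nonempty_inter_compact w.2.2
  refine ⟨hfin.toFinset, TestMap.ext fun x => ?_⟩
  change evalₗ ℝ x w = evalₗ ℝ x _
  rw [map_sum]
  change w x = ∑ n ∈ hfin.toFinset, h n x • w x
  rw [← Finset.sum_smul]
  by_cases hx : w x = 0
  · rw [hx, smul_zero]
  · rw [← finsum_eq_sum_of_support_subset, hh1, one_smul]
    intro n hn
    simpa using ⟨x, hhV n hn, subset_tsupport _ hx⟩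

variable [FiniteDimensional ℝ EM] [SigmaCompactSpace M] [IsManifold 𝓘(ℝ, EM) (r : WithTop ℕ∞) M]
  [FiniteDimensional ℝ EN] [SigmaCompactSpace N] [IsManifold 𝓘(ℝ, EN) (s : WithTop ℕ∞) N]

/-- An almost local map of finitely many test maps is continuous if it is continuous on the
steps of the direct limit. -/
theorem TestMap.continuousOn_of_almostLocal {Ω : Set (TestMap r EM M E)} (hΩ : IsOpen Ω) {k : ℕ}
    {G : TestMap r EM M E × (Fin k → TestMap r EM M E) → TestMap s EN N F}
    {U : ℕ → Set M} {V : ℕ → Set N} (hU : IsLocFinRelCompactCover U)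
    (hV : IsLocFinRelCompactCover V)
    (hG : ∀ n, ∀ x ∈ Ω, ∀ x' ∈ Ω, ∀ y y', EqOn x x' (U n) → (∀ i, EqOn (y i) (y' i) (U n)) →
      EqOn (G (x, y)) (G (x', y')) (V n))
    (hK : ∀ K : Compacts M, ContinuousOn
      (fun p : TestMapIn r EM M E K × (Fin k → TestMapIn r EM M E K) =>
        G (p.1.incl, fun i => (p.2 i).incl)) ((TestMapIn.incl ⁻¹' Ω) ×ˢ univ)) :
    ContinuousOn G (Ω ×ˢ univ) := by
  obtain ⟨χ, hχ, hχc, hχ1, hχK⟩ := hU.exists_plateau (EM := EM) r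
  obtain ⟨h, hh, hhV, hh1⟩ := hV.exists_partition (EM := EN) s
  rintro ⟨x, y⟩ ⟨hx, -⟩
  refine ContinuousAt.continuousWithinAt fun O hO => ?_
  have hO' : (fun w => G (x, y) + w) ⁻¹' O ∈ 𝓝 (0 : TestMap s EN N F) :=
    (continuous_const.add continuous_id).continuousAt.preimage_mem_nhds (by simpa using hO)
  obtain ⟨W, ⟨hW0, hWo, hWc⟩, hWO⟩ :=
    (LocallyConvexSpace.convex_open_basis_zero ℝ (TestMap s EN N F)).mem_iff.1 hO'
  have hWn : W ∈ 𝓝 (0 : TestMap s EN N F) := hWo.mem_nhds hW0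
  have hWa : Absorbent ℝ W := absorbent_nhds_zero hWn
  -- The `ε n` have sum at most `1/2`, leaving room for the strict bound `1` on the gauge.
  obtain ⟨ε, hε, c, hc, hc1⟩ := posSumOfEncodable (one_half_pos (α := ℝ)) ℕ
  let L : ℕ → Compacts N := fun n => ⟨closure (V n), hV.isCompact_closure n⟩
  have hL : ∀ n, tsupport (h n) ⊆ L n := fun n => closure_mono (hhV n)
  let S : ℕ → TestMap s EN N F →ₗ[ℝ] TestMap s EN N F :=
    fun n => inclₗ ℝ (L n) ∘ₗ mulₗ ℝ (hh n) (L n) (hL n)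
  have hS : ∀ n, Continuous (S n) := fun n =>
    (continuous_incl (L n)).comp (continuous_mulₗ (hh n) (L n) (hL n))
  obtain ⟨K₀, hxK, hyK⟩ := exists_compacts_tsupport_subset x y
  -- Adding `K₀` puts `x`, all `y i` and the products with `χ n` into one step.
  let K : ℕ → Compacts M := fun n => ⟨tsupport (χ n), hχc n⟩ ⊔ K₀
  have hχs : ∀ n, tsupport (χ n) ⊆ K n := fun n => subset_union_left
  have hK₀ : ∀ n, (K₀ : Set M) ⊆ K n := fun n => subset_union_right
  have hP : ∀ n, ∃ P ∈ 𝓝 (0 : TestMapIn r EM M E (K n)), AbsConvex ℝ P ∧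
      ∀ ξ ∈ P, ∀ η : Fin k → TestMapIn r EM M E (K n), (∀ i, η i ∈ P) →
        x + ξ.incl ∈ Ω ∧
          gauge W (S n (G (x + ξ.incl, fun i => y i + (η i).incl) - G (x, y))) < ε n := by
    intro n
    let p₀ : TestMapIn r EM M E (K n) × (Fin k → TestMapIn r EM M E (K n)) :=
      (x.restrict (K n) (hxK.trans (hK₀ n)), fun i => (y i).restrict (K n) ((hyK i).trans (hK₀ n)))
    let H : TestMapIn r EM M E (K n) × (Fin k → TestMapIn r EM M E (K n)) → TestMap s EN N F :=
      fun p => G (p.1.incl, fun i => (p.2 i).incl)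
    have hΩn : (TestMapIn.incl ⁻¹' Ω) ×ˢ univ ∈ 𝓝 p₀ :=
      prod_mem_nhds ((continuous_incl (K n)).continuousAt.preimage_mem_nhds (hΩ.mem_nhds hx))
        univ_mem
    have hHc : ContinuousAt H p₀ := (hK (K n)).continuousAt hΩn
    have hg : ContinuousAt (fun p => gauge W (S n (H p - H p₀))) p₀ :=
      ((continuous_gauge hWc hWn).comp (hS n)).continuousAt.comp (hHc.sub continuousAt_const)
    have hgε : ∀ᶠ p in 𝓝 p₀, gauge W (S n (H p - H p₀)) < ε n :=
      hg.eventually_lt continuousAt_const (by simpa using hε n)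
    have ht : Tendsto (fun p => p₀ + p) (𝓝 0) (𝓝 p₀) := by
      have h := (tendsto_id (x := 𝓝 (0 : TestMapIn r EM M E (K n) ×
        (Fin k → TestMapIn r EM M E (K n))))).const_add p₀
      rwa [add_zero] at h
    have hmem := ht (inter_mem hΩn hgε)
    rw [mem_map, ← Prod.mk_zero_zero, mem_nhds_prod_iff] at hmem
    obtain ⟨u, hu, v, hv, huv⟩ := hmem
    obtain ⟨w, hw, hwv⟩ := exists_mem_nhds_forall_mem_of_mem_nhds_pi
      (A := TestMapIn r EM M E (K n)) (a := 0) hv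
    obtain ⟨P, ⟨hP, hPc⟩, hPu⟩ := (nhds_hasBasis_absConvex ℝ (TestMapIn r EM M E (K n))).mem_iff.1
      (inter_mem hu hw)
    refine ⟨P, hP, hPc, fun ξ hξ η hη => ?_⟩
    have := huv (mk_mem_prod (hPu hξ).1 (hwv η fun i => (hPu (hη i)).2))
    exact ⟨this.1.1, this.2⟩
  choose P hP hPc hPε using hP
  have hQ := setOf_forall_mulₗ_mem_nhds_zero hχ hχK K hχs hP hPc
  have h1 : ∀ᶠ p : TestMap r EM M E × (Fin k → TestMap r EM M E) in 𝓝 (x, y), p.1 ∈ Ω :=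
    continuous_fst.continuousAt.preimage_mem_nhds (hΩ.mem_nhds hx)
  have ht1 : Tendsto (fun p : TestMap r EM M E × (Fin k → TestMap r EM M E) => p.1 - x)
      (𝓝 (x, y)) (𝓝 0) := by
    have h := ((continuous_fst (X := TestMap r EM M E)
      (Y := Fin k → TestMap r EM M E)).tendsto (x, y)).sub_const x
    rwa [sub_self] at h
  have ht2 : ∀ i, Tendsto (fun p : TestMap r EM M E × (Fin k → TestMap r EM M E) => p.2 i - y i)
      (𝓝 (x, y)) (𝓝 0) := fun i => by
    have h := (((_root_.continuous_apply i).comp (continuous_snd (X := TestMap r EM M E)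
      (Y := Fin k → TestMap r EM M E))).tendsto (x, y)).sub_const (y i)
    simpa using h
  have h2 := ht1 hQ
  have h3 := eventually_all.2 fun i => (ht2 i).eventually hQ
  rw [mem_map]
  filter_upwards [h1, h2, h3] with p hp1 hp2 hp3
  have hSn : ∀ n, gauge W (S n (G p - G (x, y))) < ε n := by
    intro n
    obtain ⟨hξΩ, hlt⟩ := hPε n _ (hp2 n) (fun i => mulₗ ℝ (hχ n) (K n) (hχs n) (p.2 i - y i))
      fun i => hp3 i n
    -- Localisation by the plateau: `b + χ n • (a - b)` equals `a` on `U n`, so `G` cannot tell them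
    -- apart on `V n`, where `h n` lives.
    have hplat : ∀ a b : TestMap r EM M E,
        EqOn a (b + (mulₗ ℝ (hχ n) (K n) (hχs n) (a - b)).incl : TestMap r EM M E) (U n) :=
      fun a b z hz => by
        change a z = b z + χ n z • (a z - b z)
        rw [hχ1 n z hz, one_smul, add_sub_cancel]
    have heq := hG n p.1 hp1 _ hξΩ p.2 _ (hplat p.1 x) fun i => hplat (p.2 i) (y i)
    convert hlt using 2
    refine TestMap.ext fun z => ?_
    change h n z • (G p z - G (x, y) z) = h n z • (G _ z - G (x, y) z)
    by_cases hz : h n z = 0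
    · rw [hz, zero_smul, zero_smul]
    · rw [← heq (hhV n hz)]
  obtain ⟨J, hJ⟩ := exists_eq_sum_mulₗ hV hh hhV hh1 L hL (G p - G (x, y))
  -- `J` depends on `p`, but the bound `c` does not.
  have hlt : gauge W (G p - G (x, y)) < 1 := by
    calc gauge W (G p - G (x, y)) = gauge W (∑ n ∈ J, S n (G p - G (x, y))) := congrArg _ hJ
      _ ≤ ∑ n ∈ J, gauge W (S n (G p - G (x, y))) := gauge_sum_le hWc hWa J _
      _ ≤ ∑ n ∈ J, ε n := Finset.sum_le_sum fun n _ => (hSn n).le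
      _ ≤ c := sum_le_hasSum J (fun n _ => (hε n).le) hc
      _ < 1 := hc1.trans_lt one_half_lt_one
  have hmem := hWO (setOfPred_gauge_lt_one_subset_self hWc hW0 hWa hlt)
  simpa using hmem

end AlmostLocal

end

theorem proposition4p7 {𝕜 : Type*} [RCLike 𝕜]
    {EM : Type*} [NormedAddCommGroup EM] [NormedSpace ℝ EM] [FiniteDimensional ℝ EM]
    {EN : Type*} [NormedAddCommGroup EN] [NormedSpace ℝ EN] [FiniteDimensional ℝ EN]
    (r s t : ℕ∞)
    {M : Type*} [TopologicalSpace M] [T2Space M] [SigmaCompactSpace M]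
    [ChartedSpace EM M] [IsManifold 𝓘(ℝ, EM) (r : WithTop ℕ∞) M]
    {N : Type*} [TopologicalSpace N] [T2Space N] [SigmaCompactSpace N]
    [ChartedSpace EN N] [IsManifold 𝓘(ℝ, EN) (s : WithTop ℕ∞) N]
    {E : Type*} [AddCommGroup E] [Module 𝕜 E] [Module ℝ E] [IsScalarTower ℝ 𝕜 E]
    [TopologicalSpace E] [IsTopologicalAddGroup E] [ContinuousSMul 𝕜 E]
    [ContinuousSMul ℝ E] [LocallyConvexSpace ℝ E] [T2Space E]
    {F : Type*} [AddCommGroup F] [Module 𝕜 F] [Module ℝ F] [IsScalarTower ℝ 𝕜 F]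
    [TopologicalSpace F] [IsTopologicalAddGroup F] [ContinuousSMul 𝕜 F]
    [ContinuousSMul ℝ F] [LocallyConvexSpace ℝ F] [T2Space F]
    (Ω : Set (TestMap r EM M E)) (hΩ : IsOpen Ω)
    (f : TestMap r EM M E → TestMap s EN N F) (hf : IsAlmostLocalOn f Ω)
    (hK : ∀ K : Compacts M,
      IsCkOn 𝕜 t (fun γ : TestMapIn r EM M E K => f γ.incl) (TestMapIn.incl ⁻¹' Ω)) :
    IsCkOn 𝕜 t f Ω := by
  obtain ⟨U, V, hU, hV, hloc⟩ := hf
  have hd : ∀ k : ℕ, (k : ℕ∞) < t → ∀ y : Fin k → TestMap r EM M E, ∀ x ∈ Ω, ∀ v,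
      ∃ d, HasDirDeriv 𝕜 (iterDirDeriv 𝕜 f k y) x v d :=
    fun k hk y x hx v => TestMap.exists_hasDirDeriv hK hk y hx v
  refine ⟨hd, fun k hk => ?_⟩
  refine TestMap.continuousOn_of_almostLocal hΩ hU hV (fun n x hx x' hx' y y' h hy =>
    TestMap.eqOn_iterDirDeriv hΩ hd (hloc n) hk hy hx hx' h) fun K => ?_
  -- On a step, `d^k f` is `d^k` of the restriction of `f`.
  exact ((hK K).continuousOn k hk).congr fun p _ =>
    (iterDirDeriv_comp_linearMap (TestMap.inclₗ 𝕜 K) f k p.2 p.1).symm
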